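/- Let $Q^+$ be the $8$-vertex graph formed by the $12$ edges of the $3$-dimensional cube together with one long diagonal (an edge joining two antipodal vertices). Let $\mathrm{ex}(a,b,Q^+)$ be the maximum number of edges in a $Q^+$-free subgraph of the complete bipartite graph $K_{a,b}$, and let $\mathrm{ex}(n,Q^+)$ be the maximum number of edges in a $Q^+$-free graph on $n$ vertices, where a graph is $Q^+$-free if it does not contain $Q^+$ as a (not necessarily induced) subgraph. Then there is an absolute constant $C$ such that for all $a,b$ $$\mathrm{ex}(a,b,Q^+)\le 2^{3/5}(ab)^{4/5}+C\left(ab^{1/2}+a^{1/2}b\right),$$ and there is an absolute constant $C'$ such that for all $n$ $$\mathrm{ex}(n,Q^+)\le n^{8/5}+C'n^{3/2}.$$ -/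

import Mathlib

open scoped Classical in
/-- `hostExtremalNumber G H` is `ex(G, H)`: the maximum number of edges in an `H`-free subgraph of
the finite graph `G`. Here `H`-free means containing no copy of `H` as a (not necessarily induced)
subgraph. -/
noncomputable def hostExtremalNumber {V W : Type*} [Fintype V] (G : SimpleGraph V)
    (H : SimpleGraph W) : ℕ :=
  (Finset.univ.filter fun G' : SimpleGraph V => G' ≤ G ∧ H.Free G').sup
    fun G' => G'.edgeFinset.card

/-- The bipartite Turán number `ex(a, b, H) = ex(K_{a,b}, H)`. -/
noncomputable def bipartiteExtremalNumber {W : Type*} (a b : ℕ) (H : SimpleGraph W) : ℕ :=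
  hostExtremalNumber (completeBipartiteGraph (Fin a) (Fin b)) H

/-- The graph of the cube: the vertices are the 0-1 vectors of length three, and two of them are
adjacent when they differ in exactly one coordinate. -/
def cubeGraph : SimpleGraph (Fin 3 → Bool) where
  Adj x y := hammingDist x y = 1
  symm := ⟨fun x y h => by rwa [hammingDist_comm]⟩
  loopless := ⟨fun x h => by simp at h⟩

/-- The cube with one long diagonal added, from `(0,0,0)` to `(1,1,1)`. -/
def cubePlusGraph : SimpleGraph (Fin 3 → Bool) :=
  cubeGraph ⊔ SimpleGraph.edge (fun _ => false) (fun _ => true)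

/-! Deleting both ends of the long diagonal from Q⁺ leaves a six-cycle whose vertices are joined
alternately to these two ends. So for each edge xy of a Q⁺-free bipartite graph, the graph between
N(y) \ {x} and N(x) \ {y} has no six-cycle. A six-cycle-free bipartite graph with sides u, v has at
most 2(uv)^{2/3} + 4(u + v) edges (`HexagonFree.card_le`), so up to lower-order terms at most
2(d(x)d(y))^{2/3} three-edge walks join x to y (`CubePlusFree.card_walks_le`).

Against this stands a weighted Cauchy–Schwarz lower bound for closed four-walks
(`sum_pow_four_le_of_walks_le`). With weights A = d(x)^{1/3} and B = d(y)^{1/3} it gives, to leading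
order, e⁴ ≤ (ΣA)²(ΣB)² · 2e. The power mean inequality gives ΣA ≤ a^{2/3}e^{1/3} and ΣB ≤
b^{2/3}e^{1/3}, whence e^{5/3} ≤ 2(ab)^{4/3}: the main term. In a minimal counterexample all degrees
are at least half the average of their side (`card_le_of_forall_large_degree`), so a small
correction of the weights absorbs the lower-order terms.

For the six-cycle bound, the graph is split into two graphs that are also free of four-cycles. In
each of these at most one three-edge path joins two given vertices, and Hölder's inequality over the
edges bounds their number.

A general graph has a cut with at least half of its edges. There ab ≤ n²/4, and 2 · 2^{3/5} ·
4^{-4/5} = 1 gives the constant. -/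

open Finset Function

/-! ### Degrees and minimal counterexamples -/

/-- The degree of a left vertex in the bipartite graph with edge set `E`. -/
def leftDegree {α β : Type*} [DecidableEq α] (E : Finset (α × β)) (x : α) : ℕ :=
  #{p ∈ E | p.1 = x}

/-- The degree of a right vertex in the bipartite graph with edge set `E`. -/
def rightDegree {α β : Type*} [DecidableEq β] (E : Finset (α × β)) (y : β) : ℕ :=
  #{p ∈ E | p.2 = y}

section Degrees

variable {α β : Type*} {S : Finset α} {T : Finset β} {E : Finset (α × β)}

theorem sum_fst_eq_sum_leftDegree [DecidableEq α] (hE : E ⊆ S ×ˢ T) (f : α → ℝ) :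
    ∑ p ∈ E, f p.1 = ∑ x ∈ S, (leftDegree E x : ℝ) * f x := by
  rw [← sum_fiberwise_of_maps_to (t := S) (g := Prod.fst)
    (fun p hp => (mem_product.1 (hE hp)).1)]
  refine sum_congr rfl fun x _ => ?_
  rw [sum_congr rfl (g := fun _ => f x), sum_const, nsmul_eq_mul, leftDegree]
  intro p hp
  rw [(mem_filter.1 hp).2]

theorem sum_snd_eq_sum_rightDegree [DecidableEq β] (hE : E ⊆ S ×ˢ T) (f : β → ℝ) :
    ∑ p ∈ E, f p.2 = ∑ y ∈ T, (rightDegree E y : ℝ) * f y := by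
  rw [← sum_fiberwise_of_maps_to (t := T) (g := Prod.snd)
    (fun p hp => (mem_product.1 (hE hp)).2)]
  refine sum_congr rfl fun x _ => ?_
  rw [sum_congr rfl (g := fun _ => f x), sum_const, nsmul_eq_mul, rightDegree]
  intro p hp
  rw [(mem_filter.1 hp).2]

theorem sum_leftDegree [DecidableEq α] (hE : E ⊆ S ×ˢ T) : ∑ x ∈ S, (leftDegree E x : ℝ) = #E := by
  simpa using (sum_fst_eq_sum_leftDegree hE fun _ => 1).symm

theorem sum_rightDegree [DecidableEq β] (hE : E ⊆ S ×ˢ T) : ∑ y ∈ T, (rightDegree E y : ℝ) = #E := by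
  simpa using (sum_snd_eq_sum_rightDegree hE fun _ => 1).symm

/-- To bound the number of edges in a hereditary class of bipartite graphs, it is enough to
consider graphs violating the bound in which the degrees are at least as large as forced by the
deletion of a vertex. -/
theorem card_le_of_forall_large_degree [DecidableEq α] [DecidableEq β] (P : Finset (α × β) → Prop)
    (hP : ∀ E F, F ⊆ E → P E → P F) (B : ℕ → ℕ → ℝ) (hB : ∀ s t, 0 ≤ B s t)
    (h : ∀ S T E, E ⊆ S ×ˢ T → P E → B #S #T < #E →
      (∀ x ∈ S, (#E : ℝ) * (B #S #T - B (#S - 1) #T) ≤ leftDegree E x * B #S #T) →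
      (∀ y ∈ T, (#E : ℝ) * (B #S #T - B #S (#T - 1)) ≤ rightDegree E y * B #S #T) → False)
    (S : Finset α) (T : Finset β) (E : Finset (α × β)) (hE : E ⊆ S ×ˢ T) (hPE : P E) :
    (#E : ℝ) ≤ B #S #T := by
  induction hn : #S + #T generalizing S T E with
  | zero =>
    have : S = ∅ := card_eq_zero.1 (by omega)
    subst this
    have : E = ∅ := by simpa using hE
    subst this
    simpa using hB _ _
  | succ n ih =>
    by_contra hlt
    push Not at hlt
    -- With e > B and e - d ≤ b, the degree satisfies d ≥ e - b, and dB ≥ e(B - b) follows because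
    -- bB ≤ be.
    have key : ∀ (F : Finset (α × β)) (d : ℕ) (b : ℝ), #F + d = #E → 0 ≤ b → (#F : ℝ) ≤ b →
        (#E : ℝ) * (B #S #T - b) ≤ d * B #S #T := by
      intro F d b h1 h2 h3
      have h1' : (#F : ℝ) + d = #E := by exact_mod_cast h1
      nlinarith [hB #S #T, mul_le_mul_of_nonneg_left hlt.le h2,
        mul_le_mul_of_nonneg_right h3 (hB #S #T)]
    refine h S T E hE hPE hlt (fun x hx => ?_) (fun y hy => ?_)
    · refine key {p ∈ E | ¬ p.1 = x} _ _ ?_ (hB _ _) ?_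
      · rw [leftDegree, add_comm, card_filter_add_card_filter_not]
      · have hc := card_erase_of_mem hx
        have hpos := card_pos.2 ⟨x, hx⟩
        rw [← hc]
        refine ih (S.erase x) T _ ?_ (hP _ _ (filter_subset _ _) hPE) (by omega)
        intro p hp
        have hp' := mem_filter.1 hp
        have := mem_product.1 (hE hp'.1)
        exact mem_product.2 ⟨mem_erase.2 ⟨hp'.2, this.1⟩, this.2⟩
    · refine key {p ∈ E | ¬ p.2 = y} _ _ ?_ (hB _ _) ?_
      · rw [rightDegree, add_comm, card_filter_add_card_filter_not]
      · have hc := card_erase_of_mem hy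
        have hpos := card_pos.2 ⟨y, hy⟩
        rw [← hc]
        refine ih S (T.erase y) _ ?_ (hP _ _ (filter_subset _ _) hPE) (by omega)
        intro p hp
        have hp' := mem_filter.1 hp
        have := mem_product.1 (hE hp'.1)
        exact mem_product.2 ⟨this.1, mem_erase.2 ⟨hp'.2, this.2⟩⟩

end Degrees

/-! ### Hölder, power mean and Cauchy–Schwarz estimates -/

section Inequalities

/-- A form of Hölder's inequality for three functions. -/
theorem card_pow_three_le {ι : Type*} (s : Finset ι) (f g h : ι → ℝ) {F G H : ℝ}
    (hf : ∀ i ∈ s, 0 < f i) (hg : ∀ i ∈ s, 0 < g i) (hh : ∀ i ∈ s, 0 < h i)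
    (hfgh : ∀ i ∈ s, f i * g i * h i = 1) (hF : ∑ i ∈ s, f i ≤ F) (hG : ∑ i ∈ s, g i ≤ G)
    (hH : ∑ i ∈ s, h i ≤ H) : (#s : ℝ) ^ 3 ≤ F * G * H := by
  obtain rfl | hs := s.eq_empty_or_nonempty
  · simp only [sum_empty] at hF hG hH
    simpa using mul_nonneg (mul_nonneg hF hG) hH
  have hF0 := (sum_pos hf hs).trans_le hF
  have hG0 := (sum_pos hg hs).trans_le hG
  have hH0 := (sum_pos hh hs).trans_le hH
  set K : ℝ := (F * G * H) ^ (1 / 3 : ℝ) with hK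
  have hFGH : 0 < F * G * H := by positivity
  have hK0 : 0 < K := by positivity
  have hK3 : K ^ 3 = F * G * H := by
    rw [hK, ← Real.rpow_natCast, ← Real.rpow_mul hFGH.le]; norm_num
  -- AM-GM for the normalised values f/F, g/G, h/H, whose product is 1/(FGH) = K⁻³ at every index.
  have key : ∀ i ∈ s, 3 / K ≤ f i / F + g i / G + h i / H := by
    intro i hi
    have h1 := Real.geom_mean_le_arith_mean3_weighted (w₁ := 1 / 3) (w₂ := 1 / 3) (w₃ := 1 / 3)
      (p₁ := f i / F) (p₂ := g i / G) (p₃ := h i / H) (by norm_num) (by norm_num) (by norm_num)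
      (div_nonneg (hf i hi).le hF0.le) (div_nonneg (hg i hi).le hG0.le)
      (div_nonneg (hh i hi).le hH0.le) (by norm_num)
    rw [← Real.mul_rpow (div_nonneg (hf i hi).le hF0.le) (div_nonneg (hg i hi).le hG0.le),
      ← Real.mul_rpow (mul_nonneg (div_nonneg (hf i hi).le hF0.le)
        (div_nonneg (hg i hi).le hG0.le)) (div_nonneg (hh i hi).le hH0.le),
      div_mul_div_comm, div_mul_div_comm, hfgh i hi, Real.div_rpow zero_le_one hFGH.le,
      Real.one_rpow, ← hK] at h1
    have : 3 / K = 3 * (1 / K) := by ring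
    linarith
  have h2 := sum_le_sum key
  rw [sum_const, nsmul_eq_mul, sum_add_distrib, sum_add_distrib, ← sum_div, ← sum_div,
    ← sum_div] at h2
  have h3 : (#s : ℝ) * (3 / K) ≤ 3 := by
    linarith [(div_le_one hF0).2 hF, (div_le_one hG0).2 hG, (div_le_one hH0).2 hH]
  have h4 : (#s : ℝ) ≤ K := by
    have : (#s : ℝ) * (3 / K) = 3 * (#s / K) := by ring
    rw [← div_le_one hK0]; linarith
  rw [← hK3]
  gcongr

/-- The power mean inequality for exponents below one. -/
theorem sum_rpow_le {ι : Type*} (s : Finset ι) (f : ι → ℝ) (hf : ∀ i ∈ s, 0 ≤ f i) {p : ℝ}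
    (hp0 : 0 ≤ p) (hp1 : p ≤ 1) :
    ∑ i ∈ s, f i ^ p ≤ (#s : ℝ) ^ (1 - p) * (∑ i ∈ s, f i) ^ p := by
  obtain rfl | hs := s.eq_empty_or_nonempty
  · simp only [sum_empty, card_empty]; positivity
  have hc : (0 : ℝ) < #s := by exact_mod_cast hs.card_pos
  have := (Real.concaveOn_rpow hp0 hp1).le_map_sum (t := s) (w := fun _ => (#s : ℝ)⁻¹) (p := f)
    (fun _ _ => by positivity) (by simp [hc.ne']) hf
  simp only [smul_eq_mul, ← mul_sum] at this
  rw [Real.mul_rpow (by positivity) (sum_nonneg hf), Real.inv_rpow hc.le] at this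
  rw [Real.rpow_sub hc, Real.rpow_one]
  have h2 := mul_le_mul_of_nonneg_left this hc.le
  rw [mul_inv_cancel_left₀ hc.ne'] at h2
  calc _ ≤ _ := h2
    _ = _ := by ring

theorem natCast_sub_one_rpow_le {n : ℕ} (hn : 0 < n) {p : ℝ} (hp0 : 0 ≤ p) (hp1 : p ≤ 1) :
    ((n - 1 : ℕ) : ℝ) ^ p ≤ (n : ℝ) ^ p * (1 - p / n) := by
  have hn' : (1 : ℝ) ≤ n := by exact_mod_cast hn
  have hn0 : (0 : ℝ) < n := by linarith
  have h1 : (-1 : ℝ) ≤ -(1 / n) := by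
    rw [neg_le_neg_iff, div_le_one hn0]; exact hn'
  have h := rpow_one_add_le_one_add_mul_self h1 hp0 hp1
  have h2 : ((n - 1 : ℕ) : ℝ) = n * (1 + -(1 / n)) := by
    rw [Nat.cast_sub hn]; field_simp; push_cast; ring
  rw [h2, Real.mul_rpow hn0.le (by linarith)]
  refine mul_le_mul_of_nonneg_left (h.trans_eq ?_) (by positivity)
  ring

/-- A weighted form of the lower bound for the number of four-cycles in a bipartite graph. -/
theorem sum_pow_four_le_mul_sum {α β : Type*} (S : Finset α) (T : Finset β) (M : α → β → ℝ)
    (A : α → ℝ) (B : β → ℝ) (hA : ∀ x ∈ S, 0 < A x) (hB : ∀ y ∈ T, 0 < B y) :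
    (∑ x ∈ S, ∑ y ∈ T, M x y) ^ 4 ≤ (∑ x ∈ S, A x) ^ 2 * (∑ y ∈ T, B y) ^ 2 *
      ∑ x ∈ S, ∑ x' ∈ S, ∑ y ∈ T, ∑ y' ∈ T,
        (M x y * M x' y * (M x y' * M x' y')) / (A x * A x' * (B y * B y')) := by
  obtain rfl | hS := S.eq_empty_or_nonempty
  · simp
  obtain rfl | hT := T.eq_empty_or_nonempty
  · simp
  have hA0 := sum_pos hA hS
  have hB0 := sum_pos hB hT
  -- Cauchy–Schwarz is used twice: here over y with weights B, then over pairs (x, x') with weights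
  -- A x * A x'.
  have h1 := sq_sum_div_le_sum_sq_div T (fun y => ∑ x ∈ S, M x y) hB
  rw [div_le_iff₀ hB0, sum_comm] at h1
  set c : α → α → ℝ := fun x x' => ∑ y ∈ T, M x y * M x' y / B y with hc
  have h2 : ∑ y ∈ T, (∑ x ∈ S, M x y) ^ 2 / B y = ∑ p ∈ S ×ˢ S, c p.1 p.2 := by
    rw [sum_product, hc]
    simp only [sq, sum_mul_sum, sum_div]
    rw [sum_comm]
    exact sum_congr rfl fun x _ => sum_comm
  rw [h2] at h1
  have h3 := sq_sum_div_le_sum_sq_div (S ×ˢ S) (fun p => c p.1 p.2) (g := fun p => A p.1 * A p.2)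
    (fun p hp => mul_pos (hA _ (mem_product.1 hp).1) (hA _ (mem_product.1 hp).2))
  have h4 : ∑ p ∈ S ×ˢ S, A p.1 * A p.2 = (∑ x ∈ S, A x) ^ 2 := by
    rw [sum_product, sq, sum_mul_sum]
  rw [h4, div_le_iff₀ (by positivity)] at h3
  have h5 : ∑ p ∈ S ×ˢ S, c p.1 p.2 ^ 2 / (A p.1 * A p.2) =
      ∑ x ∈ S, ∑ x' ∈ S, ∑ y ∈ T, ∑ y' ∈ T,
        (M x y * M x' y * (M x y' * M x' y')) / (A x * A x' * (B y * B y')) := by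
    rw [sum_product]
    refine sum_congr rfl fun x _ => sum_congr rfl fun x' _ => ?_
    simp only [hc, sq, sum_mul_sum, sum_div]
    refine sum_congr rfl fun y _ => sum_congr rfl fun y' _ => ?_
    rw [div_mul_div_comm, div_div, mul_comm (A x * A x')]
  rw [← h5]
  calc (∑ x ∈ S, ∑ y ∈ T, M x y) ^ 4 = ((∑ x ∈ S, ∑ y ∈ T, M x y) ^ 2) ^ 2 := by ring
    _ ≤ ((∑ p ∈ S ×ˢ S, c p.1 p.2) * ∑ y ∈ T, B y) ^ 2 := by gcongr
    _ = (∑ p ∈ S ×ˢ S, c p.1 p.2) ^ 2 * (∑ y ∈ T, B y) ^ 2 := by ring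
    _ ≤ _ := mul_le_mul_of_nonneg_right h3 (by positivity)
    _ = _ := by ring

/-- If the number of three-edge walks joining the ends of each edge `xy` is at most
`K (A x * B y) ^ 2`, then the number of edges is bounded in terms of the sums of `A` and `B`. -/
theorem sum_pow_four_le_of_walks_le {α β : Type*} (S : Finset α) (T : Finset β)
    (M : α → β → ℝ) (A : α → ℝ) (B : β → ℝ) (K : ℝ) (hM : ∀ x y, 0 ≤ M x y)
    (hA : ∀ x ∈ S, 0 < A x) (hB : ∀ y ∈ T, 0 < B y)
    (h : ∀ x ∈ S, ∀ y ∈ T, M x y * ∑ x' ∈ S, ∑ y' ∈ T, M x' y * M x y' * M x' y' ≤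
      M x y * (K * (A x * B y) ^ 2)) :
    (∑ x ∈ S, ∑ y ∈ T, M x y) ^ 4 ≤ (∑ x ∈ S, A x) ^ 2 * (∑ y ∈ T, B y) ^ 2 *
      (K * ∑ x ∈ S, ∑ y ∈ T, M x y) := by
  refine (sum_pow_four_le_mul_sum S T M A B hA hB).trans ?_
  refine mul_le_mul_of_nonneg_left ?_ (by positivity)
  set W : α → α → β → β → ℝ := fun x x' y y' => M x y * M x' y * (M x y' * M x' y') with hW
  have hW0 : ∀ x x' y y', 0 ≤ W x x' y y' := fun x x' y y' =>
    mul_nonneg (mul_nonneg (hM _ _) (hM _ _)) (mul_nonneg (hM _ _) (hM _ _))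
  set Z : ℝ := ∑ x ∈ S, ∑ x' ∈ S, ∑ y ∈ T, ∑ y' ∈ T, W x x' y y' / (A x * B y) ^ 2 with hZ
  have hZ' : ∑ x ∈ S, ∑ x' ∈ S, ∑ y ∈ T, ∑ y' ∈ T, W x x' y y' / (A x' * B y') ^ 2 = Z := by
    rw [hZ, sum_comm]
    refine sum_congr rfl fun x _ => sum_congr rfl fun x' _ => ?_
    rw [sum_comm]
    refine sum_congr rfl fun y _ => sum_congr rfl fun y' _ => ?_
    simp only [hW]; ring
  -- AM-GM between the opposite edges xy and x'y' of the closed walk. Exchanging them preserves W,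
  -- so both halves sum to Z, in which the weight depends on the edge xy alone.
  have h1 : ∑ x ∈ S, ∑ x' ∈ S, ∑ y ∈ T, ∑ y' ∈ T,
      W x x' y y' / (A x * A x' * (B y * B y')) ≤ (Z + Z) / 2 := by
    nth_rewrite 2 [← hZ']
    rw [hZ]
    simp only [← sum_add_distrib, sum_div]
    refine sum_le_sum fun x hx => sum_le_sum fun x' hx' => sum_le_sum fun y hy =>
      sum_le_sum fun y' hy' => ?_
    have a1 := hA x hx
    have a2 := hA x' hx'
    have b1 := hB y hy
    have b2 := hB y' hy'
    have e1 : W x x' y y' / (A x * A x' * (B y * B y')) =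
        W x x' y y' * ((A x * B y)⁻¹ * (A x' * B y')⁻¹) := by field_simp
    have e2 : (W x x' y y' / (A x * B y) ^ 2 + W x x' y y' / (A x' * B y') ^ 2) / 2 =
        W x x' y y' * ((((A x * B y)⁻¹) ^ 2 + ((A x' * B y')⁻¹) ^ 2) / 2) := by field_simp
    rw [e1, e2]
    refine mul_le_mul_of_nonneg_left ?_ (hW0 _ _ _ _)
    nlinarith [sq_nonneg ((A x * B y)⁻¹ - (A x' * B y')⁻¹)]
  refine h1.trans ?_
  rw [add_self_div_two, hZ, mul_sum]
  refine sum_le_sum fun x hx => ?_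
  rw [sum_comm, mul_sum]
  refine sum_le_sum fun y hy => ?_
  simp only [← sum_div]
  have := mul_pos (hA x hx) (hB y hy)
  rw [div_le_iff₀ (by positivity)]
  refine le_trans (le_of_eq ?_) ((h x hx y hy).trans (le_of_eq (by ring)))
  simp only [mul_sum]
  refine sum_congr rfl fun x' _ => sum_congr rfl fun y' _ => ?_
  simp only [hW]; ring

end Inequalities

/-! ### Bipartite graphs without four-cycles and six-cycles -/

/-- The bipartite graph with edge set `E` contains no four-cycle. -/
def SquareFree {α β : Type*} (E : Finset (α × β)) : Prop :=
  ∀ ⦃x x' : α⦄ ⦃y y' : β⦄, x ≠ x' → y ≠ y' → (x, y) ∈ E → (x, y') ∈ E → (x', y) ∈ E →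
    (x', y') ∈ E → False

/-- The bipartite graph with edge set `E` contains no six-cycle. -/
def HexagonFree {α β : Type*} (E : Finset (α × β)) : Prop :=
  ∀ ⦃x₀ x₁ x₂ : α⦄ ⦃y₀ y₁ y₂ : β⦄, x₀ ≠ x₁ → x₀ ≠ x₂ → x₁ ≠ x₂ → y₀ ≠ y₁ → y₀ ≠ y₂ → y₁ ≠ y₂ →
    (x₀, y₁) ∈ E → (x₀, y₂) ∈ E → (x₁, y₀) ∈ E → (x₁, y₂) ∈ E → (x₂, y₀) ∈ E → (x₂, y₁) ∈ E →
    False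

section Neighbors

variable {α β : Type*} [DecidableEq α] [DecidableEq β] {E : Finset (α × β)}

/-- The neighbors of a right vertex. -/
def leftNeighbors (E : Finset (α × β)) (y : β) : Finset α := {p ∈ E | p.2 = y}.image Prod.fst

/-- The neighbors of a left vertex. -/
def rightNeighbors (E : Finset (α × β)) (x : α) : Finset β := {p ∈ E | p.1 = x}.image Prod.snd

@[simp]
theorem mem_leftNeighbors {x : α} {y : β} : x ∈ leftNeighbors E y ↔ (x, y) ∈ E := by
  simp [leftNeighbors]

@[simp]
theorem mem_rightNeighbors {x : α} {y : β} : y ∈ rightNeighbors E x ↔ (x, y) ∈ E := by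
  simp [rightNeighbors]

theorem card_leftNeighbors (y : β) : #(leftNeighbors E y) = rightDegree E y := by
  refine card_image_of_injOn ?_
  rintro ⟨a, b⟩ h ⟨c, d⟩ h' (rfl : a = c)
  have h1 := (mem_filter.1 h).2
  have h2 := (mem_filter.1 h').2
  exact Prod.ext rfl (h1.trans h2.symm)

theorem card_rightNeighbors (x : α) : #(rightNeighbors E x) = leftDegree E x := by
  refine card_image_of_injOn ?_
  rintro ⟨a, b⟩ h ⟨c, d⟩ h' (rfl : b = d)
  have h1 := (mem_filter.1 h).2
  have h2 := (mem_filter.1 h').2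
  exact Prod.ext (h1.trans h2.symm) rfl

end Neighbors

section Girth

variable {α β : Type*} [DecidableEq α] [DecidableEq β]

/-- In a bipartite graph without four-cycles and six-cycles, two vertices are joined by at most
one path with three edges. -/
theorem sum_degree_sub_one_mul_le {S : Finset α} {T : Finset β} {E : Finset (α × β)}
    (hE : E ⊆ S ×ˢ T) (h4 : SquareFree E) (h6 : HexagonFree E) :
    ∑ p ∈ E, (rightDegree E p.2 - 1) * (leftDegree E p.1 - 1) ≤ #S * #T := by
  set Q : α × β → Finset (α × β) := fun p =>
    (leftNeighbors E p.2).erase p.1 ×ˢ (rightNeighbors E p.1).erase p.2 with hQ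
  have hcard : ∀ p ∈ E, (rightDegree E p.2 - 1) * (leftDegree E p.1 - 1) = #(Q p) := by
    intro p hp
    rw [hQ, card_product, card_erase_of_mem (by simpa using hp),
      card_erase_of_mem (by simpa using hp), card_leftNeighbors, card_rightNeighbors]
  rw [sum_congr rfl hcard, ← card_product, ← card_biUnion]
  · refine card_le_card (biUnion_subset.2 fun p _ q hq => ?_)
    simp only [hQ, mem_product, mem_erase, mem_leftNeighbors, mem_rightNeighbors] at hq
    have h1 := mem_product.1 (hE hq.1.2)
    have h2 := mem_product.1 (hE hq.2.2)
    exact mem_product.2 ⟨h1.1, h2.2⟩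
  · rintro ⟨x, y⟩ hp ⟨x', y'⟩ hp' hne
    refine disjoint_left.2 ?_
    rintro ⟨u, v⟩ h h'
    simp only [hQ, mem_product, mem_erase, mem_leftNeighbors, mem_rightNeighbors] at h h'
    obtain ⟨⟨hux, huy⟩, hvy, hxv⟩ := h
    obtain ⟨⟨hux', huy'⟩, hvy', hxv'⟩ := h'
    by_cases hx : x = x'
    · subst hx
      have hy : y ≠ y' := fun h => hne (by rw [h])
      exact h4 hux.symm hy hp hp' huy huy'
    by_cases hy : y = y'
    · subst hy
      exact h4 hx hvy.symm hp hxv hp' hxv'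
    exact h6 (x₀ := x) (x₁ := u) (x₂ := x') (y₀ := y') (y₁ := v) (y₂ := y) hux.symm hx hux'
      hvy'.symm (Ne.symm hy) hvy hxv hp huy' huy hp' hxv'

/-- Hölder over the edges, for three functions with product 1: (d(y) - 1)(d(x) - 1), whose sum is at
most st by uniqueness of three-edge paths, and the reciprocals of its two factors. The degree bounds
keep d/(d - 1) close to 1, so the reciprocals sum to little more than s and t. -/
theorem card_pow_three_le_of_squareFree_hexagonFree {S : Finset α} {T : Finset β}
    {E : Finset (α × β)} (hE : E ⊆ S ×ˢ T) (h4 : SquareFree E) (h6 : HexagonFree E) {s t p : ℝ}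
    (hs : s = #S) (ht : t = #T) (hs0 : 0 < s) (ht0 : 0 < t) (hp0 : 0 < p)
    (hp3 : p ^ 3 = (s * t) ^ 2)
    (hdx : ∀ x ∈ S, 2 / 3 * (p / s) + 1 ≤ (leftDegree E x : ℝ) - 1)
    (hdy : ∀ y ∈ T, 2 / 3 * (p / t) + 1 ≤ (rightDegree E y : ℝ) - 1) :
    (#E : ℝ) ^ 3 ≤ p * (p + 2 * s) * (p + 2 * t) := by
  have hinv : ∀ {r d : ℝ}, 0 < r → 2 / 3 * (p / r) + 1 ≤ d - 1 →
      d * (d - 1)⁻¹ ≤ 1 + 2 * r / p := by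
    intro r d hr h
    have hpr : 0 < p / r := by positivity
    have hd : 0 < d - 1 := by linarith
    have h1 : (d - 1)⁻¹ ≤ (2 / 3 * (p / r))⁻¹ := inv_anti₀ (by positivity) (by linarith)
    have h2 : (2 / 3 * (p / r))⁻¹ = 3 / 2 * (r / p) := by field_simp
    have h3 : d * (d - 1)⁻¹ = 1 + (d - 1)⁻¹ := by field_simp; ring
    have h4 : 0 < r / p := by positivity
    have h5 : 2 * r / p = 2 * (r / p) := by ring
    rw [h3, h5]
    linarith
  have hx0 : ∀ x ∈ S, 0 < (leftDegree E x : ℝ) - 1 := fun x hx => by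
    have := hdx x hx
    have : 0 < p / s := by positivity
    linarith
  have hy0 : ∀ y ∈ T, 0 < (rightDegree E y : ℝ) - 1 := fun y hy => by
    have := hdy y hy
    have : 0 < p / t := by positivity
    linarith
  have hES : ∀ q ∈ E, q.1 ∈ S := fun q hq => (mem_product.1 (hE hq)).1
  have hET : ∀ q ∈ E, q.2 ∈ T := fun q hq => (mem_product.1 (hE hq)).2
  have hmain := card_pow_three_le E
    (fun q => ((rightDegree E q.2 : ℝ) - 1) * ((leftDegree E q.1 : ℝ) - 1))
    (fun q => ((leftDegree E q.1 : ℝ) - 1)⁻¹) (fun q => ((rightDegree E q.2 : ℝ) - 1)⁻¹)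
    (F := s * t) (G := s * (1 + 2 * s / p)) (H := t * (1 + 2 * t / p))
    (fun q hq => mul_pos (hy0 _ (hET q hq)) (hx0 _ (hES q hq)))
    (fun q hq => inv_pos.2 (hx0 _ (hES q hq))) (fun q hq => inv_pos.2 (hy0 _ (hET q hq)))
    (fun q hq => by
      have h1 := (hx0 _ (hES q hq)).ne'
      have h2 := (hy0 _ (hET q hq)).ne'
      field_simp) ?_ ?_ ?_
  · have h1 : s * t * (s * (1 + 2 * s / p)) * (t * (1 + 2 * t / p)) =
        p * (p + 2 * s) * (p + 2 * t) := by
      have : s * t * (s * (1 + 2 * s / p)) * (t * (1 + 2 * t / p)) =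
        (s * t) ^ 2 * (1 + 2 * s / p) * (1 + 2 * t / p) := by ring
      rw [this, ← hp3]
      field_simp
    exact hmain.trans_eq h1
  · have h1 := sum_degree_sub_one_mul_le hE h4 h6
    have h2 : (((∑ q ∈ E, (rightDegree E q.2 - 1) * (leftDegree E q.1 - 1) : ℕ)) : ℝ) ≤ s * t := by
      rw [hs, ht, ← Nat.cast_mul]
      exact Nat.cast_le.2 h1
    rw [Nat.cast_sum] at h2
    refine le_trans (le_of_eq (sum_congr rfl fun q hq => ?_)) h2
    have a1 := hx0 _ (hES q hq)
    have a2 := hy0 _ (hET q hq)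
    rw [Nat.cast_mul, Nat.cast_sub, Nat.cast_sub, Nat.cast_one]
    · have : (1 : ℝ) ≤ leftDegree E q.1 := by linarith
      exact_mod_cast this
    · have : (1 : ℝ) ≤ rightDegree E q.2 := by linarith
      exact_mod_cast this
  · rw [sum_fst_eq_sum_leftDegree hE (fun x => ((leftDegree E x : ℝ) - 1)⁻¹)]
    refine (sum_le_sum fun x hx => hinv hs0 (hdx x hx)).trans_eq ?_
    rw [sum_const, nsmul_eq_mul, hs]
  · rw [sum_snd_eq_sum_rightDegree hE (fun x => ((rightDegree E x : ℝ) - 1)⁻¹)]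
    refine (sum_le_sum fun x hx => hinv ht0 (hdy x hx)).trans_eq ?_
    rw [sum_const, nsmul_eq_mul, ht]

/-- The term 2(s + t) pays for the `- 1` in the degrees: with p = (st)^{2/3}, removing a vertex of S
lowers the bound by at least (2/3)p/s + 2, so a minimal counterexample has d(x) - 1 ≥ (2/3)p/s + 1,
and similarly on the other side. -/
theorem card_le_of_squareFree_hexagonFree (S : Finset α) (T : Finset β) (E : Finset (α × β))
    (hE : E ⊆ S ×ˢ T) (h4 : SquareFree E) (h6 : HexagonFree E) :
    (#E : ℝ) ≤ (#S : ℝ) ^ (2 / 3 : ℝ) * (#T : ℝ) ^ (2 / 3 : ℝ) + 2 * (#S + #T) := by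
  refine card_le_of_forall_large_degree (fun E => SquareFree E ∧ HexagonFree E)
    (fun E F hFE h => ⟨fun x x' y y' h1 h2 a b c d => h.1 h1 h2 (hFE a) (hFE b) (hFE c) (hFE d),
      fun x₀ x₁ x₂ y₀ y₁ y₂ h1 h2 h3 h4 h5 h6 a b c d e f => h.2 h1 h2 h3 h4 h5 h6 (hFE a)
        (hFE b) (hFE c) (hFE d) (hFE e) (hFE f)⟩)
    (fun s t => (s : ℝ) ^ (2 / 3 : ℝ) * (t : ℝ) ^ (2 / 3 : ℝ) + 2 * (s + t))
    (fun s t => by positivity) ?_ S T E hE ⟨h4, h6⟩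
  clear hE h4 h6 S T E
  rintro S T E hE ⟨h4, h6⟩ hlt hdS hdT
  beta_reduce at hlt hdS hdT
  have hEne : E.Nonempty := by
    rw [nonempty_iff_ne_empty]
    rintro rfl
    simp only [card_empty, Nat.cast_zero] at hlt
    exact absurd hlt (not_lt.2 (by positivity))
  obtain ⟨p₀, hp₀⟩ := hEne
  have hS : 0 < #S := card_pos.2 ⟨_, (mem_product.1 (hE hp₀)).1⟩
  have hT : 0 < #T := card_pos.2 ⟨_, (mem_product.1 (hE hp₀)).2⟩
  have hs : (0 : ℝ) < #S := by exact_mod_cast hS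
  have ht : (0 : ℝ) < #T := by exact_mod_cast hT
  set s : ℝ := ((#S : ℕ) : ℝ) with hsdef
  set t : ℝ := ((#T : ℕ) : ℝ) with htdef
  have hs1 : ((#S - 1 : ℕ) : ℝ) = s - 1 := by push_cast [Nat.cast_sub hS]; ring
  have ht1 : ((#T - 1 : ℕ) : ℝ) = t - 1 := by push_cast [Nat.cast_sub hT]; ring
  set p : ℝ := s ^ (2 / 3 : ℝ) * t ^ (2 / 3 : ℝ) with hp
  have hp0 : 0 < p := by positivity
  have hp3 : p ^ 3 = (s * t) ^ 2 := by
    rw [hp, ← Real.mul_rpow hs.le ht.le, ← Real.rpow_natCast, ← Real.rpow_mul (by positivity),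
      ← Real.rpow_natCast]
    norm_num
  have hlow : ∀ {d b : ℝ}, (#E : ℝ) * (p + 2 * (s + t) - b) ≤ d * (p + 2 * (s + t)) →
      b ≤ p + 2 * (s + t) → p + 2 * (s + t) - b ≤ d := by
    intro d b h1 h2
    have hB : 0 < p + 2 * (s + t) := by positivity
    refine le_of_mul_le_mul_right (le_trans ?_ h1) hB
    rw [mul_comm]
    exact mul_le_mul_of_nonneg_right hlt.le (by linarith)
  have hdx : ∀ x ∈ S, 2 / 3 * (p / s) + 1 ≤ (leftDegree E x : ℝ) - 1 := by
    intro x hx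
    have h1 := natCast_sub_one_rpow_le hS (p := 2 / 3) (by norm_num) (by norm_num)
    rw [← hsdef, hs1] at h1
    have h2 := mul_le_mul_of_nonneg_right h1 (by positivity : 0 ≤ t ^ (2 / 3 : ℝ))
    have h3 : s ^ (2 / 3 : ℝ) * (1 - 2 / 3 / s) * t ^ (2 / 3 : ℝ) = p - 2 / 3 * (p / s) := by
      rw [hp]; ring
    rw [h3] at h2
    have h4 : 0 < p / s := by positivity
    have := hlow (hdS x hx) (by rw [hs1]; linarith)
    rw [hs1] at this
    linarith
  have hdy : ∀ y ∈ T, 2 / 3 * (p / t) + 1 ≤ (rightDegree E y : ℝ) - 1 := by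
    intro y hy
    have h1 := natCast_sub_one_rpow_le hT (p := 2 / 3) (by norm_num) (by norm_num)
    rw [← htdef, ht1] at h1
    have h2 := mul_le_mul_of_nonneg_left h1 (by positivity : 0 ≤ s ^ (2 / 3 : ℝ))
    have h3 : s ^ (2 / 3 : ℝ) * (t ^ (2 / 3 : ℝ) * (1 - 2 / 3 / t)) = p - 2 / 3 * (p / t) := by
      rw [hp]; ring
    rw [h3] at h2
    have h4 : 0 < p / t := by positivity
    have := hlow (hdT y hy) (by rw [ht1]; linarith)
    rw [ht1] at this
    linarith
  have hmain := card_pow_three_le_of_squareFree_hexagonFree hE h4 h6 hsdef htdef hs ht hp0 hp3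
    hdx hdy
  have h2 : p * (p + 2 * s) * (p + 2 * t) ≤ (p + 2 * (s + t)) ^ 3 := by
    have e1 : p * (p + 2 * s) ≤ (p + 2 * (s + t)) * (p + 2 * (s + t)) := by gcongr <;> linarith
    calc _ ≤ (p + 2 * (s + t)) * (p + 2 * (s + t)) * (p + 2 * (s + t)) := by
          gcongr; linarith
      _ = _ := by ring
  have h3 : (p + 2 * (s + t)) ^ 3 < (#E : ℝ) ^ 3 := by gcongr
  linarith

end Girth

/-! ### Bipartite graphs without six-cycles -/

section Hexagon

variable {α β : Type*} {E : Finset (α × β)}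

/-- The path `x y' x' y` completes the edge `xy` to a four-cycle. -/
def Completes (E : Finset (α × β)) (x : α) (y : β) (x' : α) (y' : β) : Prop :=
  x' ≠ x ∧ y' ≠ y ∧ (x, y') ∈ E ∧ (x', y) ∈ E ∧ (x', y') ∈ E

/-- All the four-cycles through the edge `xy` have the same left vertices. -/
def LeftType (E : Finset (α × β)) (x : α) (y : β) : Prop :=
  ∀ ⦃x₁ y₁ x₂ y₂⦄, Completes E x y x₁ y₁ → Completes E x y x₂ y₂ → x₁ = x₂

/-- Otherwise x y₁ x₁ y x₂ y₂ is a six-cycle. Hence the pairs completing an edge all agree in one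
coordinate; an edge in no four-cycle counts as left type. -/
theorem HexagonFree.eq_or_eq (h : HexagonFree E) {x x₁ x₂ : α} {y y₁ y₂ : β}
    (h₁ : Completes E x y x₁ y₁) (h₂ : Completes E x y x₂ y₂) : x₁ = x₂ ∨ y₁ = y₂ := by
  by_contra! hne
  exact h (x₀ := x) (x₁ := x₁) (x₂ := x₂) (y₀ := y) (y₁ := y₂) (y₂ := y₁) h₁.1.symm h₂.1.symm
    hne.1 h₂.2.1.symm h₁.2.1.symm hne.2.symm h₂.2.2.1 h₁.2.2.1 h₁.2.2.2.1 h₁.2.2.2.2 h₂.2.2.2.1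
    h₂.2.2.2.2

/-- All the four-cycles through an edge have the same right vertices if they do not have the same
left vertices. -/
theorem HexagonFree.eq_of_not_leftType (h : HexagonFree E) {x : α} {y : β}
    (hxy : ¬ LeftType E x y) {x₁ x₂ : α} {y₁ y₂ : β}
    (h₁ : Completes E x y x₁ y₁) (h₂ : Completes E x y x₂ y₂) : y₁ = y₂ := by
  have key : ∃ b, ∀ u v, Completes E x y u v → v = b := by
    unfold LeftType at hxy
    push Not at hxy
    obtain ⟨a, b, c, d, hab, hcd, hac⟩ := hxy
    refine ⟨b, fun u v huv => ?_⟩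
    have hbd := (h.eq_or_eq hab hcd).resolve_left hac
    by_contra hv
    have e1 := (h.eq_or_eq huv hab).resolve_right hv
    have e2 := (h.eq_or_eq huv hcd).resolve_right (hbd ▸ hv)
    exact hac (e1.symm.trans e2)
  obtain ⟨b, hb⟩ := key
  rw [hb _ _ h₁, hb _ _ h₂]

theorem HexagonFree.exists_ne_of_not_leftType (h : HexagonFree E) {x x' : α} {y y' : β}
    (hxy : ¬ LeftType E x y) (h' : Completes E x y x' y') :
    ∃ x₁, x₁ ≠ x' ∧ Completes E x y x₁ y' := by
  by_contra! hcon
  refine hxy fun x₁ y₁ x₂ y₂ h₁ h₂ => ?_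
  have e1 := h.eq_of_not_leftType hxy h₁ h'
  have e2 := h.eq_of_not_leftType hxy h₂ h'
  subst e1 e2
  have a1 : x₁ = x' := by by_contra hne; exact hcon _ hne h₁
  have a2 : x₂ = x' := by by_contra hne; exact hcon _ hne h₂
  rw [a1, a2]

/-- The type is constant along a four-cycle: if x'y were not of left type, a further common neighbor
u of y and y' would complete xy with a left vertex other than x'. -/
theorem HexagonFree.leftType_of_completes_left (h : HexagonFree E) {x x' : α} {y y' : β}
    (hE : (x, y) ∈ E) (hc : Completes E x y x' y') (hxy : LeftType E x y) : LeftType E x' y := by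
  by_contra hn
  obtain ⟨u, hu, hc'⟩ := h.exists_ne_of_not_leftType hn
    (show Completes E x' y x y' from ⟨hc.1.symm, hc.2.1, hc.2.2.2.2, hE, hc.2.2.1⟩)
  exact hc'.1 (hxy (show Completes E x y u y' from
    ⟨hu, hc.2.1, hc.2.2.1, hc'.2.2.2.1, hc'.2.2.2.2⟩) hc)

theorem HexagonFree.leftType_of_completes_right (h : HexagonFree E) {x x' : α} {y y' : β}
    (hE : (x, y) ∈ E) (hc : Completes E x y x' y') (hxy : LeftType E x y) : LeftType E x y' := by
  by_contra hn
  obtain ⟨u, hu, hc'⟩ := h.exists_ne_of_not_leftType hn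
    (show Completes E x y' x' y from ⟨hc.1, hc.2.1.symm, hE, hc.2.2.2.2, hc.2.2.2.1⟩)
  exact hu (hxy (show Completes E x y u y' from
    ⟨hc'.1, hc.2.1, hc.2.2.1, hc'.2.2.2.2, hc'.2.2.2.1⟩) hc)

/-- All edges of a four-cycle in F have the same type. For left type the edges xy and x'y demand
both r x x' and r x' x; otherwise xy and xy' make opposite demands on r'. The relations are kept
general to serve both < and >. -/
theorem HexagonFree.squareFree_filter (h : HexagonFree E) (r : α → α → Prop) (r' : β → β → Prop)
    (hr : ∀ a b, r a b → ¬ r b a) (hr' : ∀ a b, r' a b → ¬ r' b a) {F : Finset (α × β)}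
    (hF : ∀ p ∈ F, p ∈ E ∧ ∀ x' y', Completes E p.1 p.2 x' y' →
      (LeftType E p.1 p.2 → r p.1 x') ∧ (¬ LeftType E p.1 p.2 → r' p.2 y')) :
    SquareFree F := by
  intro x x' y y' hx hy h1 h2 h3 h4
  obtain ⟨m1, f1⟩ := hF _ h1
  obtain ⟨m2, f2⟩ := hF _ h2
  obtain ⟨m3, f3⟩ := hF _ h3
  obtain ⟨m4, f4⟩ := hF _ h4
  have c1 : Completes E x y x' y' := ⟨hx.symm, hy.symm, m2, m3, m4⟩
  have c2 : Completes E x y' x' y := ⟨hx.symm, hy, m1, m4, m3⟩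
  have c3 : Completes E x' y x y' := ⟨hx, hy.symm, m4, m1, m2⟩
  by_cases ht : LeftType E x y
  · exact hr _ _ ((f1 _ _ c1).1 ht) ((f3 _ _ c3).1 (h.leftType_of_completes_left m1 c1 ht))
  · exact hr' _ _ ((f1 _ _ c1).2 ht)
      ((f2 _ _ c2).2 fun ht' => ht (h.leftType_of_completes_right m2 c2 ht'))

/-- A bipartite graph without six-cycles is the union of two graphs without four-cycles. -/
theorem HexagonFree.exists_squareFree_cover [LinearOrder α] [LinearOrder β] (h : HexagonFree E) :
    ∃ F F' : Finset (α × β), F ⊆ E ∧ F' ⊆ E ∧ E ⊆ F ∪ F' ∧ SquareFree F ∧ SquareFree F' := by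
  classical
  refine ⟨{p ∈ E | ∀ x' y', Completes E p.1 p.2 x' y' →
      (LeftType E p.1 p.2 → p.1 < x') ∧ (¬ LeftType E p.1 p.2 → p.2 < y')},
    {p ∈ E | ∀ x' y', Completes E p.1 p.2 x' y' →
      (LeftType E p.1 p.2 → p.1 > x') ∧ (¬ LeftType E p.1 p.2 → p.2 > y')},
    filter_subset _ _, filter_subset _ _, ?_, ?_, ?_⟩
  · rintro ⟨x, y⟩ hp
    rw [mem_union, mem_filter, mem_filter]
    by_contra! hcon
    obtain ⟨⟨x₁, y₁, h₁, n₁⟩, x₂, y₂, h₂, n₂⟩ := And.intro (hcon.1 hp) (hcon.2 hp)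
    by_cases ht : LeftType E x y
    · have := ht h₁ h₂
      subst this
      rcases lt_or_gt_of_ne h₁.1 with hlt | hlt
      · exact (n₂ fun _ => hlt).1 ht
      · exact (n₁ fun _ => hlt).1 ht
    · have := h.eq_of_not_leftType ht h₁ h₂
      subst this
      rcases lt_or_gt_of_ne h₁.2.1 with hlt | hlt
      · exact absurd hlt (not_lt.2 (n₂ fun h => absurd h ht).2)
      · exact absurd hlt (not_lt.2 (n₁ fun h => absurd h ht).2)
  · exact h.squareFree_filter (· < ·) (· < ·) (fun _ _ h => h.asymm) (fun _ _ h => h.asymm)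
      fun p hp => mem_filter.1 hp
  · exact h.squareFree_filter (· > ·) (· > ·) (fun _ _ h => h.asymm) (fun _ _ h => h.asymm)
      fun p hp => mem_filter.1 hp

theorem HexagonFree.mono {F : Finset (α × β)} (h : HexagonFree E) (hFE : F ⊆ E) :
    HexagonFree F :=
  fun _ _ _ _ _ _ h1 h2 h3 h4 h5 h6 a b c d e f => h h1 h2 h3 h4 h5 h6 (hFE a)
    (hFE b) (hFE c) (hFE d) (hFE e) (hFE f)

/-- An upper bound for the number of edges of a bipartite graph without six-cycles. -/
theorem HexagonFree.card_le [LinearOrder α] [LinearOrder β] (h : HexagonFree E) {S : Finset α}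
    {T : Finset β} (hE : E ⊆ S ×ˢ T) :
    (#E : ℝ) ≤ 2 * ((#S : ℝ) ^ (2 / 3 : ℝ) * (#T : ℝ) ^ (2 / 3 : ℝ)) + 4 * (#S + #T) := by
  obtain ⟨F, F', hF, hF', hcov, h1, h2⟩ := h.exists_squareFree_cover
  have e1 := card_le_of_squareFree_hexagonFree S T F (hF.trans hE) h1 (h.mono hF)
  have e2 := card_le_of_squareFree_hexagonFree S T F' (hF'.trans hE) h2 (h.mono hF')
  have e3 : (#E : ℝ) ≤ #F + #F' := by
    exact_mod_cast (card_le_card hcov).trans (card_union_le _ _)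
  linarith

end Hexagon

/-! ### Three-edge walks in graphs without Q⁺ -/

/-- The bipartite graph with edge set `E` contains no cube with a long diagonal. The diagonal
joins `x₀` and `y₀`, and the other six vertices form a six-cycle in the neighborhoods of these. -/
def CubePlusFree {α β : Type*} (E : Finset (α × β)) : Prop :=
  ∀ ⦃x₀ x₁ x₂ x₃ : α⦄ ⦃y₀ y₁ y₂ y₃ : β⦄, x₁ ≠ x₀ → x₂ ≠ x₀ → x₃ ≠ x₀ →
    x₁ ≠ x₂ → x₁ ≠ x₃ → x₂ ≠ x₃ → y₁ ≠ y₀ → y₂ ≠ y₀ → y₃ ≠ y₀ → y₁ ≠ y₂ → y₁ ≠ y₃ → y₂ ≠ y₃ →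
    (x₀, y₀) ∈ E → (x₀, y₁) ∈ E → (x₀, y₂) ∈ E → (x₀, y₃) ∈ E →
    (x₁, y₀) ∈ E → (x₂, y₀) ∈ E → (x₃, y₀) ∈ E →
    (x₁, y₂) ∈ E → (x₁, y₃) ∈ E → (x₂, y₁) ∈ E → (x₂, y₃) ∈ E → (x₃, y₁) ∈ E → (x₃, y₂) ∈ E →
    False

section Walks

variable {α β : Type*} {E : Finset (α × β)}

theorem CubePlusFree.mono {F : Finset (α × β)} (h : CubePlusFree E) (hFE : F ⊆ E) :
    CubePlusFree F :=
  fun _ _ _ _ _ _ _ _ h1 h2 h3 h4 h5 h6 h7 h8 h9 h10 h11 h12 a b c d e f g i j k l m n =>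
    h h1 h2 h3 h4 h5 h6 h7 h8 h9 h10 h11 h12 (hFE a) (hFE b) (hFE c) (hFE d) (hFE e) (hFE f)
      (hFE g) (hFE i) (hFE j) (hFE k) (hFE l) (hFE m) (hFE n)

/-- The number of walks with three edges joining the ends of an edge. -/
theorem CubePlusFree.card_walks_le [LinearOrder α] [LinearOrder β] (h : CubePlusFree E)
    {x : α} {y : β} (hxy : (x, y) ∈ E) :
    (#{q ∈ E | (q.1, y) ∈ E ∧ (x, q.2) ∈ E} : ℝ) ≤
      2 * ((leftDegree E x : ℝ) ^ (2 / 3 : ℝ) * (rightDegree E y : ℝ) ^ (2 / 3 : ℝ)) +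
        5 * (leftDegree E x + rightDegree E y) := by
  set S := (leftNeighbors E y).erase x with hS
  set T := (rightNeighbors E x).erase y with hT
  have hH : HexagonFree (E ∩ S ×ˢ T) := by
    intro x₀ x₁ x₂ y₀ y₁ y₂ h1 h2 h3 h4 h5 h6 a b c d e f
    simp only [hS, hT, mem_inter, mem_product, mem_erase, mem_leftNeighbors,
      mem_rightNeighbors] at a b c d e f
    exact h a.2.1.1 c.2.1.1 e.2.1.1 h1 h2 h3 c.2.2.1 a.2.2.1 b.2.2.1 h4 h5 h6 hxy c.2.2.2 a.2.2.2
      b.2.2.2 a.2.1.2 c.2.1.2 e.2.1.2 a.1 b.1 c.1 d.1 e.1 f.1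
  have hc := hH.card_le inter_subset_right
  -- Walks whose middle edge meets x or y are degenerate; there are at most d(x) + d(y) of them,
  -- which raises the constant from 4 to 5.
  have hsub : {q ∈ E | (q.1, y) ∈ E ∧ (x, q.2) ∈ E} ⊆
      (E ∩ S ×ˢ T) ∪ ({p ∈ E | p.1 = x} ∪ {p ∈ E | p.2 = y}) := by
    rintro ⟨u, v⟩ hq
    simp only [mem_filter] at hq
    simp only [mem_union, mem_inter, mem_product, mem_filter, hS, hT, mem_erase,
      mem_leftNeighbors, mem_rightNeighbors]
    tauto
  have h1 : (#{q ∈ E | (q.1, y) ∈ E ∧ (x, q.2) ∈ E} : ℝ) ≤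
      #(E ∩ S ×ˢ T) + (leftDegree E x + rightDegree E y) := by
    have := (card_le_card hsub).trans ((card_union_le _ _).trans
      (Nat.add_le_add_left (card_union_le _ _) _))
    exact_mod_cast this
  have hSc : (#S : ℝ) ≤ rightDegree E y := by
    rw [← card_leftNeighbors]; exact_mod_cast card_le_card (erase_subset _ _)
  have hTc : (#T : ℝ) ≤ leftDegree E x := by
    rw [← card_rightNeighbors]; exact_mod_cast card_le_card (erase_subset _ _)
  have h2 : (#S : ℝ) ^ (2 / 3 : ℝ) * (#T : ℝ) ^ (2 / 3 : ℝ) ≤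
      (leftDegree E x : ℝ) ^ (2 / 3 : ℝ) * (rightDegree E y : ℝ) ^ (2 / 3 : ℝ) := by
    rw [mul_comm]
    gcongr
  linarith

theorem CubePlusFree.card_pow_four_le [LinearOrder α] [LinearOrder β] (h : CubePlusFree E)
    {S : Finset α} {T : Finset β} (hE : E ⊆ S ×ˢ T) (A : α → ℝ) (B : β → ℝ)
    (hA : ∀ x ∈ S, 0 < A x) (hB : ∀ y ∈ T, 0 < B y)
    (hAB : ∀ x ∈ S, ∀ y ∈ T,
      (leftDegree E x : ℝ) ^ (2 / 3 : ℝ) * (rightDegree E y : ℝ) ^ (2 / 3 : ℝ) +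
        4 * (leftDegree E x + rightDegree E y) ≤ (A x * B y) ^ 2) :
    (#E : ℝ) ^ 4 ≤ (∑ x ∈ S, A x) ^ 2 * (∑ y ∈ T, B y) ^ 2 * (2 * #E) := by
  have hfil : {p ∈ S ×ˢ T | p ∈ E} = E := by
    ext p
    simp only [mem_filter, and_iff_right_iff_imp]
    exact fun hp => hE hp
  set M : α → β → ℝ := fun x y => if (x, y) ∈ E then 1 else 0 with hM
  have hsum : ∑ x ∈ S, ∑ y ∈ T, M x y = #E := by
    rw [← sum_product', hM]
    simp only [Prod.mk.eta, sum_boole, hfil]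
  rw [← hsum]
  -- K = 2 is the constant of the six-cycle bound and fixes the main term; twice the 4 in `hAB`
  -- leaves room for the 5 in the walk count.
  refine sum_pow_four_le_of_walks_le S T M A B 2 (fun x y => ?_) hA hB fun x hx y hy => ?_
  · simp only [hM]; split_ifs <;> norm_num
  · by_cases hxy : (x, y) ∈ E
    swap
    · simp [hM, hxy]
    have h1 : ∑ x' ∈ S, ∑ y' ∈ T, M x' y * M x y' * M x' y' =
        #{q ∈ E | (q.1, y) ∈ E ∧ (x, q.2) ∈ E} := by
      rw [← sum_product' (f := fun x' y' => M x' y * M x y' * M x' y')]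
      have h2 : ∀ q : α × β, M q.1 y * M x q.2 * M q.1 q.2 =
          if ((q.1, y) ∈ E ∧ (x, q.2) ∈ E) ∧ q ∈ E then 1 else 0 := by
        intro q
        by_cases a : (q.1, y) ∈ E <;> by_cases b : (x, q.2) ∈ E <;> by_cases c : q ∈ E <;>
          simp [hM, a, b, c]
      rw [sum_congr rfl fun q _ => h2 q, sum_boole]
      congr 2
      ext q
      simp only [mem_filter]
      constructor
      · rintro ⟨-, a, b⟩; exact ⟨b, a⟩
      · rintro ⟨a, b⟩; exact ⟨hE a, b, a⟩
    rw [h1]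
    refine mul_le_mul_of_nonneg_left ?_ (by simp [hM, hxy])
    have h2 := h.card_walks_le hxy
    have h3 := hAB x hx y hy
    have h4 : (0 : ℝ) ≤ leftDegree E x := Nat.cast_nonneg _
    have h5 : (0 : ℝ) ≤ rightDegree E y := Nat.cast_nonneg _
    linarith

end Walks

/-! ### Solving for the number of edges -/

theorem five_mul_pow_add_pow_ge {μ ε : ℝ} (hμ : 0 ≤ μ) (hε : 0 ≤ ε) :
    6 * (μ ^ 5 * ε) ≤ 5 * μ ^ 6 + ε ^ 6 := by
  have : 0 ≤ (ε - μ) ^ 2 *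
      (ε ^ 4 + 2 * ε ^ 3 * μ + 3 * ε ^ 2 * μ ^ 2 + 4 * ε * μ ^ 3 + 5 * μ ^ 4) := by positivity
  nlinarith

/-- The final inequality in the variables σ = s^{1/30}, τ = t^{1/30}, ε = e^{1/6}, κ = 2^{1/10},
which make all exponents integers. A square root reduces it to ε⁶ ≤ μ⁵ε + (45/4)U with μ = κ(στ)⁴;
then μ⁵ε ≤ (5μ⁶ + ε⁶)/6 gives ε⁶ ≤ μ⁶ + (27/2)U, and 27/2 is rounded up to 14. -/
theorem pow_six_le_of_pow_le {σ τ ε κ : ℝ} (hσ : 0 < σ) (hτ : 0 < τ) (hε : 0 < ε) (hκ : 0 < κ)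
    (hκ2 : κ ^ 10 = 2) (hστ : 1 ≤ σ * τ) (hle : (σ * τ) ^ 4 ≤ ε)
    (h : (ε ^ 6) ^ 4 ≤ (σ ^ 20 * ε ^ 2 + 3 * (τ ^ 10 * σ ^ 15 * ε)) ^ 2 *
      (τ ^ 20 * ε ^ 2 + 3 * (σ ^ 10 * τ ^ 15 * ε)) ^ 2 * (2 * ε ^ 6)) :
    ε ^ 6 ≤ κ ^ 6 * (σ * τ) ^ 24 + 14 * (σ ^ 30 * τ ^ 15 + σ ^ 15 * τ ^ 30) := by
  set U := σ ^ 30 * τ ^ 15 + σ ^ 15 * τ ^ 30 with hU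
  have hU0 : 0 < U := by positivity
  have h1 : ε ^ 7 ≤ κ ^ 5 * ((σ ^ 20 * ε + 3 * (τ ^ 10 * σ ^ 15)) *
      (τ ^ 20 * ε + 3 * (σ ^ 10 * τ ^ 15))) := by
    refine le_of_sq_le_sq ?_ (by positivity)
    refine le_of_mul_le_mul_right ?_ (by positivity : 0 < ε ^ 10)
    calc (ε ^ 7) ^ 2 * ε ^ 10 = (ε ^ 6) ^ 4 := by ring
      _ ≤ _ := h
      _ = κ ^ 10 * ((σ ^ 20 * ε + 3 * (τ ^ 10 * σ ^ 15)) *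
          (τ ^ 20 * ε + 3 * (σ ^ 10 * τ ^ 15))) ^ 2 * ε ^ 10 := by rw [hκ2]; ring
      _ = _ := by ring
  have h2 : (σ * τ) ^ 21 ≤ U / 2 := by
    refine le_of_sq_le_sq ?_ (by positivity)
    have e1 : ((σ * τ) ^ 21) ^ 2 ≤ (σ * τ) ^ 45 := by
      rw [← pow_mul]; exact pow_le_pow_right₀ hστ (by norm_num)
    have e2 : (U / 2) ^ 2 = (σ * τ) ^ 45 + ((σ ^ 30 * τ ^ 15 - σ ^ 15 * τ ^ 30) / 2) ^ 2 := by
      rw [hU]; ring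
    nlinarith [sq_nonneg ((σ ^ 30 * τ ^ 15 - σ ^ 15 * τ ^ 30) / 2)]
  have h3 : (σ * τ) ^ 25 ≤ ε * (U / 2) := by
    calc (σ * τ) ^ 25 = (σ * τ) ^ 4 * (σ * τ) ^ 21 := by ring
      _ ≤ _ := by gcongr
  have h4 : κ ^ 5 ≤ 3 / 2 := by
    refine le_of_sq_le_sq ?_ (by norm_num)
    calc (κ ^ 5) ^ 2 = κ ^ 10 := by ring
      _ ≤ _ := by rw [hκ2]; norm_num
  have h5 : ε ^ 6 ≤ (κ * (σ * τ) ^ 4) ^ 5 * ε + 45 / 4 * U := by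
    refine le_of_mul_le_mul_right ?_ hε
    calc ε ^ 6 * ε = ε ^ 7 := by ring
      _ ≤ _ := h1
      _ = (κ * (σ * τ) ^ 4) ^ 5 * ε * ε + κ ^ 5 * (3 * ε * U + 9 * (σ * τ) ^ 25) := by
          rw [hU]; ring
      _ ≤ (κ * (σ * τ) ^ 4) ^ 5 * ε * ε + 3 / 2 * (3 * ε * U + 9 * (ε * (U / 2))) := by gcongr
      _ = _ := by ring
  have h6 := five_mul_pow_add_pow_ge (μ := κ * (σ * τ) ^ 4) (by positivity) hε.le
  have h7 : (κ * (σ * τ) ^ 4) ^ 6 = κ ^ 6 * (σ * τ) ^ 24 := by ring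
  linarith

theorem rpow_eq_pow_rpow {x : ℝ} (hx : 0 ≤ x) {q r : ℝ} (n : ℕ) (h : q = r * n) :
    x ^ q = (x ^ r) ^ n := by
  rw [h, Real.rpow_mul hx, Real.rpow_natCast]

/-- All exponents in `cubePlusBound` are at least 1/2, so one factor 1 - 1/(2n) serves every term.
It yields degrees of at least half the average. -/
theorem natCast_sub_one_rpow_le_half {n : ℕ} (hn : 0 < n) {p : ℝ} (hp0 : 1 / 2 ≤ p)
    (hp1 : p ≤ 1) : ((n - 1 : ℕ) : ℝ) ^ p ≤ (n : ℝ) ^ p * (1 - 1 / 2 / n) := by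
  refine (natCast_sub_one_rpow_le hn (by linarith) hp1).trans ?_
  gcongr

/-- The bound for the number of edges of bipartite graphs not containing a cube with a long
diagonal. -/
noncomputable def cubePlusBound (s t : ℕ) : ℝ :=
  (2 : ℝ) ^ (3 / 5 : ℝ) * ((s : ℝ) ^ (4 / 5 : ℝ) * (t : ℝ) ^ (4 / 5 : ℝ)) +
    14 * ((s : ℝ) ^ (1 : ℝ) * (t : ℝ) ^ (1 / 2 : ℝ) + (s : ℝ) ^ (1 / 2 : ℝ) * (t : ℝ) ^ (1 : ℝ))

theorem cubePlusBound_nonneg (s t : ℕ) : 0 ≤ cubePlusBound s t := by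
  unfold cubePlusBound; positivity

theorem cubePlusBound_comm (s t : ℕ) : cubePlusBound s t = cubePlusBound t s := by
  unfold cubePlusBound; ring

theorem cubePlusBound_sub_one_le {s : ℕ} (t : ℕ) (hs : 0 < s) :
    cubePlusBound (s - 1) t ≤ cubePlusBound s t * (1 - 1 / 2 / s) := by
  unfold cubePlusBound
  have h1 := natCast_sub_one_rpow_le_half hs (p := 4 / 5) (by norm_num) (by norm_num)
  have h2 := natCast_sub_one_rpow_le_half hs (p := 1) (by norm_num) (by norm_num)
  have h3 := natCast_sub_one_rpow_le_half hs (p := 1 / 2) (by norm_num) (by norm_num)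
  calc _ ≤ (2 : ℝ) ^ (3 / 5 : ℝ) *
        ((s : ℝ) ^ (4 / 5 : ℝ) * (1 - 1 / 2 / s) * (t : ℝ) ^ (4 / 5 : ℝ)) +
      14 * ((s : ℝ) ^ (1 : ℝ) * (1 - 1 / 2 / s) * (t : ℝ) ^ (1 / 2 : ℝ) +
        (s : ℝ) ^ (1 / 2 : ℝ) * (1 - 1 / 2 / s) * (t : ℝ) ^ (1 : ℝ)) := by gcongr
    _ = _ := by ring

theorem half_div_le_of_mul_sub_le {e d b b' s : ℝ} (he : 0 ≤ e) (hb : 0 < b)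
    (h : e * (b - b') ≤ d * b) (hb' : b' ≤ b * (1 - 1 / 2 / s)) : e / (2 * s) ≤ d := by
  refine le_of_mul_le_mul_right (le_trans ?_ h) hb
  have h1 : e / (2 * s) * b = e * (b - b * (1 - 1 / 2 / s)) := by
    rw [show e / (2 * s) = e * (1 / 2 / s) by rw [div_div, mul_one_div]]; ring
  rw [h1]
  gcongr

/-- Since d' ≥ δ', the factor δ'^{-1/3}d'^{1/3} is at least 1, so the cross terms of the product are
at least 2d^{1/2} and 2d'^{1/2}. Their squares supply 4(d + d'). -/
theorem add_le_weight_mul_sq {d d' δ δ' : ℝ} (hδ : 0 < δ) (hδ' : 0 < δ') (hd : δ ≤ d)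
    (hd' : δ' ≤ d') :
    d ^ (2 / 3 : ℝ) * d' ^ (2 / 3 : ℝ) + 4 * (d + d') ≤
      ((d ^ (1 / 3 : ℝ) + 2 * δ' ^ (-(1 / 3) : ℝ) * d ^ (1 / 2 : ℝ)) *
        (d' ^ (1 / 3 : ℝ) + 2 * δ ^ (-(1 / 3) : ℝ) * d' ^ (1 / 2 : ℝ))) ^ 2 := by
  have hd0 := hδ.trans_le hd
  have hd0' := hδ'.trans_le hd'
  have key : ∀ {a b : ℝ}, 0 < a → a ≤ b → 1 ≤ a ^ (-(1 / 3) : ℝ) * b ^ (1 / 3 : ℝ) := by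
    intro a b ha hab
    rw [Real.rpow_neg ha.le, inv_mul_eq_div, one_le_div (by positivity)]
    gcongr
  have k1 := key hδ hd
  have k2 := key hδ' hd'
  have e1 : d ^ (2 / 3 : ℝ) = (d ^ (1 / 3 : ℝ)) ^ 2 :=
    rpow_eq_pow_rpow hd0.le 2 (by norm_num)
  have e2 : d' ^ (2 / 3 : ℝ) = (d' ^ (1 / 3 : ℝ)) ^ 2 :=
    rpow_eq_pow_rpow hd0'.le 2 (by norm_num)
  have e3 : d = (d ^ (1 / 2 : ℝ)) ^ 2 := by
    rw [← rpow_eq_pow_rpow hd0.le (q := 1) 2 (by norm_num), Real.rpow_one]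
  have e4 : d' = (d' ^ (1 / 2 : ℝ)) ^ 2 := by
    rw [← rpow_eq_pow_rpow hd0'.le (q := 1) 2 (by norm_num), Real.rpow_one]
  have e5 : d + d' = (d ^ (1 / 2 : ℝ)) ^ 2 + (d' ^ (1 / 2 : ℝ)) ^ 2 := by rw [← e3, ← e4]
  rw [e1, e2, e5]
  clear e1 e2 e3 e4 e5
  have p1 : 0 < d ^ (1 / 3 : ℝ) := by positivity
  have p2 : 0 < d' ^ (1 / 3 : ℝ) := by positivity
  have p3 : 0 < d ^ (1 / 2 : ℝ) := by positivity
  have p4 : 0 < d' ^ (1 / 2 : ℝ) := by positivity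
  have p5 : 0 < δ ^ (-(1 / 3) : ℝ) := by positivity
  have p6 : 0 < δ' ^ (-(1 / 3) : ℝ) := by positivity
  generalize d ^ (1 / 3 : ℝ) = a at *
  generalize d' ^ (1 / 3 : ℝ) = a' at *
  generalize d ^ (1 / 2 : ℝ) = c at *
  generalize d' ^ (1 / 2 : ℝ) = c' at *
  generalize δ ^ (-(1 / 3) : ℝ) = g at *
  generalize δ' ^ (-(1 / 3) : ℝ) = g' at *
  have m1 : c ≤ g' * a' * c := le_mul_of_one_le_left p3.le k2
  have m2 : c' ≤ g * a * c' := le_mul_of_one_le_left p4.le k1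
  have m3 : a * a' + 2 * c + 2 * c' ≤ (a + 2 * g' * c) * (a' + 2 * g * c') := by
    have : 0 ≤ 4 * (g' * c * (g * c')) := by positivity
    nlinarith
  calc a ^ 2 * a' ^ 2 + 4 * (c ^ 2 + c' ^ 2) ≤ (a * a' + 2 * c + 2 * c') ^ 2 := by
        have h1 := mul_pos p1 p2
        have h2 := mul_pos h1 p3
        have h3 := mul_pos h1 p4
        have h4 := mul_pos p3 p4
        nlinarith
    _ ≤ _ := by gcongr

theorem sum_weight_le {ι : Type*} (S : Finset ι) (d : ι → ℝ) (hd : ∀ i ∈ S, 0 ≤ d i) {e t : ℝ}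
    (he : ∑ i ∈ S, d i = e) (he0 : 0 < e) (ht : 0 < t) :
    ∑ i ∈ S, (d i ^ (1 / 3 : ℝ) + 2 * (e / (2 * t)) ^ (-(1 / 3) : ℝ) * d i ^ (1 / 2 : ℝ)) ≤
      (#S : ℝ) ^ (2 / 3 : ℝ) * e ^ (1 / 3 : ℝ) +
        3 * (t ^ (1 / 3 : ℝ) * (#S : ℝ) ^ (1 / 2 : ℝ) * e ^ (1 / 6 : ℝ)) := by
  rw [sum_add_distrib, ← mul_sum]
  have h1 := sum_rpow_le S d hd (p := 1 / 3) (by norm_num) (by norm_num)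
  have h2 := sum_rpow_le S d hd (p := 1 / 2) (by norm_num) (by norm_num)
  rw [he] at h1 h2
  norm_num only at h1 h2
  -- The constant 3 comes from 2 · 2^{1/3} ≤ 3.
  have h3 : 2 * (e / (2 * t)) ^ (-(1 / 3) : ℝ) ≤ 3 * (t ^ (1 / 3 : ℝ) * e ^ (-(1 / 3) : ℝ)) := by
    rw [Real.rpow_neg (by positivity), Real.div_rpow he0.le (by positivity), inv_div,
      Real.mul_rpow zero_le_two ht.le, Real.rpow_neg he0.le, div_eq_mul_inv]
    have h4 : (2 : ℝ) ^ (1 / 3 : ℝ) ≤ 3 / 2 := by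
      refine le_of_pow_le_pow_left₀ (n := 3) (by norm_num) (by norm_num) ?_
      rw [← rpow_eq_pow_rpow zero_le_two (q := 1) 3 (by norm_num)]
      norm_num
    have h5 : 0 ≤ t ^ (1 / 3 : ℝ) * (e ^ (1 / 3 : ℝ))⁻¹ := by positivity
    nlinarith
  have h6 : e ^ (1 / 6 : ℝ) = e ^ (-(1 / 3) : ℝ) * e ^ (1 / 2 : ℝ) := by
    rw [← Real.rpow_add he0]; norm_num
  rw [h6]
  have h7 : 0 ≤ ∑ i ∈ S, d i ^ (1 / 2 : ℝ) := sum_nonneg fun i hi => Real.rpow_nonneg (hd i hi) _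
  calc _ ≤ (#S : ℝ) ^ (2 / 3 : ℝ) * e ^ (1 / 3 : ℝ) +
        3 * (t ^ (1 / 3 : ℝ) * e ^ (-(1 / 3) : ℝ)) *
          ((#S : ℝ) ^ (1 / 2 : ℝ) * e ^ (1 / 2 : ℝ)) := by gcongr
    _ = _ := by ring

theorem CubePlusFree.card_le {α β : Type*} [LinearOrder α] [LinearOrder β] {E : Finset (α × β)}
    (h : CubePlusFree E) {S : Finset α} {T : Finset β} (hE : E ⊆ S ×ˢ T) :
    (#E : ℝ) ≤ cubePlusBound #S #T := by
  refine card_le_of_forall_large_degree CubePlusFree (fun E F hFE h => h.mono hFE) cubePlusBound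
    cubePlusBound_nonneg ?_ S T E hE h
  clear hE h S T E
  intro S T E hE h hlt hdS hdT
  have he : (0 : ℝ) < #E := (cubePlusBound_nonneg _ _).trans_lt hlt
  obtain ⟨p₀, hp₀⟩ : E.Nonempty := card_pos.1 (by exact_mod_cast he)
  have hS : 0 < #S := card_pos.2 ⟨_, (mem_product.1 (hE hp₀)).1⟩
  have hT : 0 < #T := card_pos.2 ⟨_, (mem_product.1 (hE hp₀)).2⟩
  have hs : (0 : ℝ) < #S := by exact_mod_cast hS
  have ht : (0 : ℝ) < #T := by exact_mod_cast hT
  have hs1 : (1 : ℝ) ≤ #S := by exact_mod_cast hS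
  have ht1 : (1 : ℝ) ≤ #T := by exact_mod_cast hT
  have hb : 0 < cubePlusBound #S #T := by unfold cubePlusBound; positivity
  have hdx : ∀ x ∈ S, (#E : ℝ) / (2 * #S) ≤ leftDegree E x := fun x hx =>
    half_div_le_of_mul_sub_le he.le hb (hdS x hx) (cubePlusBound_sub_one_le _ hS)
  have hdy : ∀ y ∈ T, (#E : ℝ) / (2 * #T) ≤ rightDegree E y := fun y hy =>
    half_div_le_of_mul_sub_le he.le hb (hdT y hy) (by
      rw [cubePlusBound_comm, cubePlusBound_comm #S]; exact cubePlusBound_sub_one_le _ hT)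
  have hδS : (0 : ℝ) < #E / (2 * #S) := by positivity
  have hδT : (0 : ℝ) < #E / (2 * #T) := by positivity
  have hwalk := h.card_pow_four_le hE
    (fun x => (leftDegree E x : ℝ) ^ (1 / 3 : ℝ) +
      2 * ((#E : ℝ) / (2 * #T)) ^ (-(1 / 3) : ℝ) * (leftDegree E x : ℝ) ^ (1 / 2 : ℝ))
    (fun y => (rightDegree E y : ℝ) ^ (1 / 3 : ℝ) +
      2 * ((#E : ℝ) / (2 * #S)) ^ (-(1 / 3) : ℝ) * (rightDegree E y : ℝ) ^ (1 / 2 : ℝ))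
    (fun x hx => by
      have := hδS.trans_le (hdx x hx)
      positivity)
    (fun y hy => by
      have := hδT.trans_le (hdy y hy)
      positivity)
    (fun x hx y hy => add_le_weight_mul_sq hδS hδT (hdx x hx) (hdy y hy))
  have hA := sum_weight_le S (fun x => (leftDegree E x : ℝ)) (fun _ _ => Nat.cast_nonneg _)
    (sum_leftDegree hE) he ht
  have hB := sum_weight_le T (fun y => (rightDegree E y : ℝ)) (fun _ _ => Nat.cast_nonneg _)
    (sum_rightDegree hE) he hs
  have hA0 : 0 ≤ ∑ x ∈ S, ((leftDegree E x : ℝ) ^ (1 / 3 : ℝ) +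
      2 * ((#E : ℝ) / (2 * #T)) ^ (-(1 / 3) : ℝ) * (leftDegree E x : ℝ) ^ (1 / 2 : ℝ)) :=
    sum_nonneg fun x _ => by positivity
  have hB0 : 0 ≤ ∑ y ∈ T, ((rightDegree E y : ℝ) ^ (1 / 3 : ℝ) +
      2 * ((#E : ℝ) / (2 * #S)) ^ (-(1 / 3) : ℝ) * (rightDegree E y : ℝ) ^ (1 / 2 : ℝ)) :=
    sum_nonneg fun y _ => by positivity
  have hmain : (#E : ℝ) ^ 4 ≤ _ := hwalk.trans (mul_le_mul_of_nonneg_right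
    (mul_le_mul (pow_le_pow_left₀ hA0 hA 2) (pow_le_pow_left₀ hB0 hB 2) (by positivity)
      (by positivity)) (by positivity))
  clear hwalk hA hB hA0 hB0 hδS hδT hdx hdy hdS hdT
  unfold cubePlusBound at hlt
  generalize ((#E : ℕ) : ℝ) = e at *
  generalize ((#S : ℕ) : ℝ) = s at *
  generalize ((#T : ℕ) : ℝ) = t at *
  refine absurd hlt (not_lt.2 ?_)
  have e1 : e = (e ^ (1 / 6 : ℝ)) ^ 6 := by
    rw [← rpow_eq_pow_rpow he.le (q := 1) 6 (by norm_num), Real.rpow_one]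
  have e2 : e ^ (1 / 3 : ℝ) = (e ^ (1 / 6 : ℝ)) ^ 2 := rpow_eq_pow_rpow he.le 2 (by norm_num)
  have hpow : ∀ {x : ℝ}, 0 < x → x ^ (2 / 3 : ℝ) = (x ^ (1 / 30 : ℝ)) ^ 20 ∧
      x ^ (1 / 3 : ℝ) = (x ^ (1 / 30 : ℝ)) ^ 10 ∧ x ^ (1 / 2 : ℝ) = (x ^ (1 / 30 : ℝ)) ^ 15 ∧
      x ^ (4 / 5 : ℝ) = (x ^ (1 / 30 : ℝ)) ^ 24 ∧ x ^ (1 : ℝ) = (x ^ (1 / 30 : ℝ)) ^ 30 :=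
    fun hx => ⟨rpow_eq_pow_rpow hx.le 20 (by norm_num), rpow_eq_pow_rpow hx.le 10 (by norm_num),
      rpow_eq_pow_rpow hx.le 15 (by norm_num), rpow_eq_pow_rpow hx.le 24 (by norm_num),
      rpow_eq_pow_rpow hx.le 30 (by norm_num)⟩
  obtain ⟨s1, s2, s3, s4, s5⟩ := hpow hs
  obtain ⟨t1, t2, t3, t4, t5⟩ := hpow ht
  have hκ6 : (2 : ℝ) ^ (3 / 5 : ℝ) = ((2 : ℝ) ^ (1 / 10 : ℝ)) ^ 6 :=
    rpow_eq_pow_rpow zero_le_two 6 (by norm_num)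
  have hκ10 : ((2 : ℝ) ^ (1 / 10 : ℝ)) ^ 10 = 2 := by
    rw [← rpow_eq_pow_rpow zero_le_two (q := 1) 10 (by norm_num), Real.rpow_one]
  have hκ1 : 1 ≤ (2 : ℝ) ^ (1 / 10 : ℝ) := Real.one_le_rpow one_le_two (by norm_num)
  have hσ1 : 1 ≤ s ^ (1 / 30 : ℝ) := Real.one_le_rpow hs1 (by norm_num)
  have hτ1 : 1 ≤ t ^ (1 / 30 : ℝ) := Real.one_le_rpow ht1 (by norm_num)
  have hε : 0 < e ^ (1 / 6 : ℝ) := by positivity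
  rw [s1, s2, s3, t1, t2, t3, e2] at hmain
  rw [s3, s4, s5, t3, t4, t5, hκ6] at hlt ⊢
  rw [e1] at hlt ⊢
  nth_rewrite 1 [e1] at hmain
  nth_rewrite 6 [e1] at hmain
  generalize e ^ (1 / 6 : ℝ) = ε at *
  generalize s ^ (1 / 30 : ℝ) = σ at *
  generalize t ^ (1 / 30 : ℝ) = τ at *
  generalize (2 : ℝ) ^ (1 / 10 : ℝ) = κ at *
  have hσ0 : 0 < σ := by linarith
  have hτ0 : 0 < τ := by linarith
  -- A counterexample exceeds the bound, so in particular e ≥ (st)^{4/5}.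
  have hle : (σ * τ) ^ 4 ≤ ε := by
    refine le_of_pow_le_pow_left₀ (n := 6) (by norm_num) hε.le ?_
    have h1 : 1 ≤ κ ^ 6 := one_le_pow₀ hκ1
    have h2 : 0 ≤ σ ^ 24 * τ ^ 24 := by positivity
    have h3 : 0 ≤ 14 * (σ ^ 30 * τ ^ 15 + σ ^ 15 * τ ^ 30) := by positivity
    calc ((σ * τ) ^ 4) ^ 6 = 1 * (σ ^ 24 * τ ^ 24) := by ring
      _ ≤ κ ^ 6 * (σ ^ 24 * τ ^ 24) := by gcongr
      _ ≤ _ := by linarith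
  rw [← mul_pow]
  exact pow_six_le_of_pow_le hσ0 hτ0 hε (by linarith) hκ10 (one_le_mul_of_one_le_of_one_le hσ1 hτ1)
    hle hmain

/-! ### From Q⁺-free graphs to bipartite edge sets -/

theorem eq_not_of_hammingDist_eq_one : ∀ v w : Fin 3 → Bool, hammingDist v w = 1 →
    (v 0 = !w 0 ∧ v 1 = w 1 ∧ v 2 = w 2) ∨ (v 0 = w 0 ∧ v 1 = !w 1 ∧ v 2 = w 2) ∨
      (v 0 = w 0 ∧ v 1 = w 1 ∧ v 2 = !w 2) := by
  decide

/-- Disjointness of the two sides is required only at vertices of E, so that f and g may be the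
inclusions into a disjoint sum or, for a cut, both the identity. -/
theorem cubePlusFree_of_free {V α β : Type*} {G : SimpleGraph V} (hG : cubePlusGraph.Free G)
    {f : α → V} {g : β → V} (hf : Injective f) (hg : Injective g) {E : Finset (α × β)}
    (hE : ∀ p ∈ E, G.Adj (f p.1) (g p.2)) (hfg : ∀ p ∈ E, ∀ q ∈ E, f p.1 ≠ g q.2) :
    CubePlusFree E := by
  intro x₀ x₁ x₂ x₃ y₀ y₁ y₂ y₃ a1 a2 a3 a4 a5 a6 b1 b2 b3 b4 b5 b6 h00 h01 h02 h03 h10 h20 h30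
    h12 h13 h21 h23 h31 h32
  have hx : ∀ x ∈ ({x₀, x₁, x₂, x₃} : Set α), ∀ y ∈ ({y₀, y₁, y₂, y₃} : Set β), f x ≠ g y := by
    intro x hx y hy
    refine hfg (x, y₀) ?_ (x₀, y) ?_
    · rcases hx with rfl | rfl | rfl | rfl <;> assumption
    · rcases hy with rfl | rfl | rfl | rfl <;> assumption
  -- The diagonal runs from x₀ at 000 to y₀ at 111; yᵢ sits at the i-th unit vector and xᵢ at the
  -- antipode of yᵢ.
  set ψ : Bool → Bool → Bool → V := fun a b c =>
    if a then if b then if c then g y₀ else f x₃ else if c then f x₂ else g y₁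
    else if b then if c then f x₁ else g y₂ else if c then g y₃ else f x₀ with hψ
  have hx' := fun x hx' y hy => (hx x hx' y hy).symm
  simp only [Set.mem_insert_iff, Set.mem_singleton_iff, forall_eq_or_imp, forall_eq] at hx hx'
  have hinj : ∀ a b c a' b' c', ψ a b c = ψ a' b' c' → a = a' ∧ b = b' ∧ c = c' := by
    intro a b c a' b' c'
    cases a <;> cases b <;> cases c <;> cases a' <;> cases b' <;> cases c' <;>
      simp [hψ, hf.eq_iff, hg.eq_iff, hx, hx', a1, a2, a3, a4, a5, a6, b1, b2, b3, b4, b5, b6,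
        a1.symm, a2.symm, a3.symm, a4.symm, a5.symm, a6.symm, b1.symm, b2.symm, b3.symm,
        b4.symm, b5.symm, b6.symm]
  have hadj : ∀ v w, cubePlusGraph.Adj v w → G.Adj (ψ (v 0) (v 1) (v 2)) (ψ (w 0) (w 1) (w 2)) := by
    have e00 := hE _ h00
    have e01 := hE _ h01
    have e02 := hE _ h02
    have e03 := hE _ h03
    have e10 := hE _ h10
    have e20 := hE _ h20
    have e30 := hE _ h30
    have e12 := hE _ h12
    have e13 := hE _ h13
    have e21 := hE _ h21
    have e23 := hE _ h23
    have e31 := hE _ h31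
    have e32 := hE _ h32
    intro v w hvw
    rcases hvw with hvw | hvw
    · rcases eq_not_of_hammingDist_eq_one v w hvw with ⟨c0, c1, c2⟩ | ⟨c0, c1, c2⟩ | ⟨c0, c1, c2⟩ <;>
        rw [c0, c1, c2] <;> cases w 0 <;> cases w 1 <;> cases w 2 <;>
        first
        | simpa [hψ]
        | (refine G.symm.symm _ _ ?_; simpa [hψ])
    · rw [SimpleGraph.edge_adj] at hvw
      rcases hvw.1 with ⟨rfl, rfl⟩ | ⟨rfl, rfl⟩
      · simpa [hψ]
      · refine G.symm.symm _ _ ?_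
        simpa [hψ]
  refine hG ⟨⟨⟨fun v => ψ (v 0) (v 1) (v 2), fun {v w} h => hadj v w h⟩, fun v w h => ?_⟩⟩
  obtain ⟨c0, c1, c2⟩ := hinj _ _ _ _ _ _ h
  funext i
  fin_cases i <;> assumption

/-- A graph has a cut that contains at least half of its edges. -/
theorem exists_card_edgeFinset_le_two_mul_cut {V : Type*} [Fintype V] [DecidableEq V]
    (G : SimpleGraph V) [DecidableRel G.Adj] :
    ∃ S : Finset V, #G.edgeFinset ≤ 2 * #{p ∈ S ×ˢ Sᶜ | G.Adj p.1 p.2} := by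
  set D : Finset (V × V) := {p | G.Adj p.1 p.2} with hD
  have hD2 : #D = 2 * #G.edgeFinset := by
    rw [hD, G.two_mul_card_edgeFinset]
  -- A quarter of all sets S contain p.1 but not p.2. Averaged over S, the 2e ordered adjacent pairs
  -- therefore yield a cut with at least e/2 edges.
  have hS : ∀ p ∈ D, #{S : Finset V | p.1 ∈ S ∧ p.2 ∉ S} * 4 = 2 ^ Fintype.card V := by
    intro p hp
    have hne : p.1 ≠ p.2 := (mem_filter.1 hp).2.ne
    have h1 : ({S : Finset V | p.1 ∈ S ∧ p.2 ∉ S} : Finset (Finset V)) = Finset.Icc {p.1} {p.2}ᶜ := by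
      ext S
      simp [Finset.subset_compl_singleton]
    have h2 : ({p.1} : Finset V) ⊆ {p.2}ᶜ := by simpa using hne.symm
    have h3 : 2 ≤ Fintype.card V := by
      have := card_le_univ ({p.1, p.2} : Finset V)
      rwa [card_pair hne] at this
    rw [h1, card_Icc_finset h2, card_compl, card_singleton, card_singleton]
    obtain ⟨k, hk⟩ := Nat.exists_eq_add_of_le h3
    rw [hk, show 2 + k - 1 - 1 = k by omega, pow_add]
    ring
  have hsum : ∑ S : Finset V, #{p ∈ D | p.1 ∈ S ∧ p.2 ∉ S} * 4 = ∑ S : Finset V, #D := by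
    rw [← sum_mul]
    have := sum_card_bipartiteAbove_eq_sum_card_bipartiteBelow (s := D)
      (t := (univ : Finset (Finset V))) (fun p S => p.1 ∈ S ∧ p.2 ∉ S)
    unfold bipartiteAbove bipartiteBelow at this
    rw [← this, sum_mul, sum_congr rfl hS, sum_const, sum_const, card_univ, Fintype.card_finset,
      smul_eq_mul, smul_eq_mul, mul_comm]
  obtain ⟨S, -, hle⟩ := exists_le_of_sum_le (univ_nonempty (α := Finset V)) hsum.ge
  refine ⟨S, ?_⟩
  have h1 : ({p ∈ D | p.1 ∈ S ∧ p.2 ∉ S} : Finset (V × V)) = {p ∈ S ×ˢ Sᶜ | G.Adj p.1 p.2} := by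
    ext p
    simp [hD, and_comm]
  rw [h1] at hle
  omega

theorem card_edgeFinset_le_cubePlusBound {a b : ℕ} {G : SimpleGraph (Fin a ⊕ Fin b)}
    [Fintype G.edgeSet] (hle : G ≤ completeBipartiteGraph (Fin a) (Fin b))
    (hG : cubePlusGraph.Free G) : (#G.edgeFinset : ℝ) ≤ cubePlusBound a b := by
  classical
  set E : Finset (Fin a × Fin b) := {p | G.Adj (.inl p.1) (.inr p.2)} with hE
  have hfree : CubePlusFree E := cubePlusFree_of_free hG Sum.inl_injective Sum.inr_injective
    (fun p hp => (mem_filter.1 hp).2) (fun _ _ _ _ => Sum.inl_ne_inr)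
  have h1 := hfree.card_le (S := univ) (T := univ) (fun p _ => by simp)
  rw [card_univ, card_univ, Fintype.card_fin, Fintype.card_fin] at h1
  refine le_trans ?_ h1
  have h2 : G.edgeFinset ⊆ E.image fun p => s(Sum.inl p.1, Sum.inr p.2) := by
    intro e he
    induction e with
    | _ u v =>
      rw [SimpleGraph.mem_edgeFinset, SimpleGraph.mem_edgeSet] at he
      have hb := hle he
      rw [mem_image]
      rcases u with u | u <;> rcases v with v | v
      · simp at hb
      · exact ⟨(u, v), by simpa [hE] using he, rfl⟩
      · exact ⟨(v, u), by simpa [hE] using he.symm, Sym2.eq_swap⟩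
      · simp at hb
  exact_mod_cast (card_le_card h2).trans card_image_le

theorem cubePlusBound_eq (a b : ℕ) : cubePlusBound a b =
    (2 : ℝ) ^ (3 / 5 : ℝ) * ((a : ℝ) * (b : ℝ)) ^ (4 / 5 : ℝ) +
      14 * ((a : ℝ) * (b : ℝ) ^ (1 / 2 : ℝ) + (a : ℝ) ^ (1 / 2 : ℝ) * (b : ℝ)) := by
  rw [cubePlusBound, Real.rpow_one, Real.rpow_one, Real.mul_rpow (by positivity) (by positivity)]

theorem two_mul_cubePlusBound_le {a b n : ℕ} (h : a + b = n) :
    2 * cubePlusBound a b ≤ (n : ℝ) ^ (8 / 5 : ℝ) + 56 * (n : ℝ) ^ (3 / 2 : ℝ) := by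
  have hn : (a : ℝ) + b = n := by exact_mod_cast h
  have ha : (0 : ℝ) ≤ a := Nat.cast_nonneg a
  have hb : (0 : ℝ) ≤ b := Nat.cast_nonneg b
  have hn0 : (0 : ℝ) ≤ n := Nat.cast_nonneg n
  have han : (a : ℝ) ≤ n := by linarith
  have hbn : (b : ℝ) ≤ n := by linarith
  -- From ab ≤ (n/2)²; the factor 2^{-8/5} cancels 2 · 2^{3/5} exactly.
  have h1 : ((a : ℝ) * b) ^ (4 / 5 : ℝ) ≤ (n : ℝ) ^ (8 / 5 : ℝ) * (2 : ℝ) ^ (-(8 / 5) : ℝ) := by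
    calc ((a : ℝ) * b) ^ (4 / 5 : ℝ) ≤ (((n : ℝ) * 2⁻¹) ^ 2) ^ (4 / 5 : ℝ) := by
          gcongr
          nlinarith [sq_nonneg ((a : ℝ) - b)]
      _ = _ := by
          rw [← Real.rpow_natCast, ← Real.rpow_mul (by positivity),
            Real.mul_rpow hn0 (by positivity), Real.inv_rpow zero_le_two,
            ← Real.rpow_neg zero_le_two]
          norm_num
  have h2 : (2 : ℝ) * (2 ^ (3 / 5 : ℝ) * 2 ^ (-(8 / 5) : ℝ)) = 1 := by
    rw [← Real.rpow_add zero_lt_two]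
    norm_num [Real.rpow_neg_one]
  have h3 : (n : ℝ) ^ (3 / 2 : ℝ) = n * (n : ℝ) ^ (1 / 2 : ℝ) := by
    rw [← Real.rpow_one_add' hn0 (by norm_num)]; norm_num
  have h4 : (a : ℝ) * (b : ℝ) ^ (1 / 2 : ℝ) ≤ n * (n : ℝ) ^ (1 / 2 : ℝ) := by gcongr
  have h5 : (a : ℝ) ^ (1 / 2 : ℝ) * (b : ℝ) ≤ (n : ℝ) ^ (1 / 2 : ℝ) * n := by gcongr
  have h6 : 2 * ((2 : ℝ) ^ (3 / 5 : ℝ) * ((a : ℝ) * b) ^ (4 / 5 : ℝ)) ≤ (n : ℝ) ^ (8 / 5 : ℝ) := by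
    calc _ ≤ 2 * ((2 : ℝ) ^ (3 / 5 : ℝ) *
          ((n : ℝ) ^ (8 / 5 : ℝ) * (2 : ℝ) ^ (-(8 / 5) : ℝ))) := by gcongr
      _ = (2 : ℝ) * (2 ^ (3 / 5 : ℝ) * 2 ^ (-(8 / 5) : ℝ)) * (n : ℝ) ^ (8 / 5 : ℝ) := by ring
      _ = _ := by rw [h2, one_mul]
  rw [cubePlusBound_eq, h3]
  linarith

theorem card_edgeFinset_le_of_cubePlusGraph_free {n : ℕ} {G : SimpleGraph (Fin n)}
    [DecidableRel G.Adj] (hG : cubePlusGraph.Free G) :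
    (#G.edgeFinset : ℝ) ≤ (n : ℝ) ^ (8 / 5 : ℝ) + 56 * (n : ℝ) ^ (3 / 2 : ℝ) := by
  obtain ⟨S, hS⟩ := exists_card_edgeFinset_le_two_mul_cut G
  have hfree : CubePlusFree {p ∈ S ×ˢ Sᶜ | G.Adj p.1 p.2} :=
    cubePlusFree_of_free hG injective_id injective_id (fun p hp => (mem_filter.1 hp).2)
      (fun p hp q hq heq => by
        have h1 := (mem_product.1 (mem_filter.1 hp).1).1
        have h2 := (mem_product.1 (mem_filter.1 hq).1).2
        rw [show p.1 = q.2 from heq] at h1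
        exact mem_compl.1 h2 h1)
  have h1 := hfree.card_le (filter_subset _ _)
  have h2 : (#G.edgeFinset : ℝ) ≤ 2 * #{p ∈ S ×ˢ Sᶜ | G.Adj p.1 p.2} := by exact_mod_cast hS
  have h3 : #S + #Sᶜ = n := by rw [card_add_card_compl, Fintype.card_fin]
  linarith [two_mul_cubePlusBound_le h3]

theorem theorem13 :
    (∃ C : ℝ, ∀ a b : ℕ,
      (bipartiteExtremalNumber a b cubePlusGraph : ℝ) ≤
        (2 : ℝ) ^ (3 / 5 : ℝ) * ((a : ℝ) * (b : ℝ)) ^ (4 / 5 : ℝ) +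
          C * ((a : ℝ) * (b : ℝ) ^ (1 / 2 : ℝ) + (a : ℝ) ^ (1 / 2 : ℝ) * (b : ℝ))) ∧
    (∃ C : ℝ, ∀ n : ℕ,
      (SimpleGraph.extremalNumber n cubePlusGraph : ℝ) ≤
        (n : ℝ) ^ (8 / 5 : ℝ) + C * (n : ℝ) ^ (3 / 2 : ℝ)) := by
  refine ⟨⟨14, fun a b => ?_⟩, 56, fun n => ?_⟩
  · classical
    -- The supremum is taken in ℕ, so the real bound is replaced by its floor.
    rw [← cubePlusBound_eq, ← Nat.le_floor_iff (cubePlusBound_nonneg a b)]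
    unfold bipartiteExtremalNumber hostExtremalNumber
    refine Finset.sup_le fun G hG => ?_
    rw [Nat.le_floor_iff (cubePlusBound_nonneg a b)]
    simp only [mem_filter, mem_univ, true_and] at hG
    exact card_edgeFinset_le_cubePlusBound hG.1 hG.2
  · have h := SimpleGraph.extremalNumber_le_iff_of_nonneg (V := Fin n) cubePlusGraph
      (m := (n : ℝ) ^ (8 / 5 : ℝ) + 56 * (n : ℝ) ^ (3 / 2 : ℝ)) (by positivity)
    rw [Fintype.card_fin] at h
    exact h.2 fun G _ hG => card_edgeFinset_le_of_cubePlusGraph_free hG
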